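/- Let $N,T\in\mathbb N$ and, for $n\in[N]$, $t\in[T]$, let $E_n>0$ and $\underline x_{n,t},\overline x_{n,t}\in\mathbb R$ be such that $$\mathcal X=\Big\{x\in\mathbb R^{NT}:\ \sum_{t}x_{n,t}=E_n\ \ \forall n,\quad \underline x_{n,t}\le x_{n,t}\le\overline x_{n,t}\ \ \forall n,t\Big\}\neq\emptyset .$$ Let $p\in\mathbb R^T$ satisfy $\sum_t p_t=\sum_n E_n$ and $\sum_n\underline x_{n,t}\le p_t\le\sum_n\overline x_{n,t}$ for all $t$, and put $\mathcal Y_p=\{y\in\mathbb R^{NT}:\sum_n y_{n,t}=p_t\ \forall t\}$. Let $\|\cdot\|$ be the Euclidean norm on $\mathbb R^{NT}$. For an arbitrary $y^{(0)}\in\mathbb R^{NT}$ let $x^{(k+1)}=P_{\mathcal X}(y^{(k)})$ and $y^{(k+1)}=P_{\mathcal Y_p}(x^{(k+1)})$, $k\ge 0$, be the iterates of the alternate projections method, and let $\rho\in(0,1)$ be a geometric rate of them, i.e. $\|x^{(k+1)}-x^{(k)}\|\le\rho\,\|x^{(k)}-x^{(k-1)}\|$ for all $k\ge2$. For a tolerance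 $\varepsilon>0$ the method stops at the first $K\ge2$ with $\|x^{(K)}-x^{(K-1)}\|<\varepsilon$. Then the limits $x^{(k)}\to x^\infty$ and $y^{(k)}\to y^\infty$ exist. Put $\nu^{(k)}_t=\frac1N\big(p_t-\sum_n x^{(k)}_{n,t}\big)$ and $\nu^\infty_t=\frac1N\big(p_t-\sum_n x^\infty_{n,t}\big)$, assume that $\nu^\infty\neq0$ (equivalently, $x^\infty\neq y^\infty$), and let $\underline\nu=\min\{|\nu^\infty_t|: |\nu^\infty_t|>0\}$. Let $$\mathcal T=\{t:\exists n,\ y^\infty_{n,t}>\overline x_{n,t}\},\qquad \mathcal N=\Big\{n: E_n-\sum_{t\notin\mathcal T}\underline x_{n,t}-\sum_{t\in\mathcal T}\overline x_{n,t}<0\Big\},\qquad A_{\mathcal T}(x)=\sum_{t\in\mathcal T}\sum_{n\in[N]}x_{n,t}.$$ If the constants $B$ and $\varepsilon>0$ satisfy $B>\frac1{1-\rho}$ and $2B\varepsilon<\underline\nu$, then the method with tolerance $\varepsilon$ stops at some finite iteration $K$, the set $\mathcal T$ is available at that iteration, $\{t: B\varepsilon<\nu^{(K)}_t\}=\mathcal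 T=\{t:\nu^\infty_t>0\}$, and $$A_{\mathcal T}(x^{(K)})=\sum_{t\in\mathcal T}\sum_{n\in[N]}x^{(K)}_{n,t}=A_{\mathcal T}(x^\infty).$$ So the exact Hoffman cut is obtained in finite time: this value is the right-hand side of Hoffman's inequality for $(\mathcal T,\mathcal N)$, and that inequality is violated by $p$, $$A_{\mathcal T}(x^\infty)=\sum_{n\in\mathcal N}E_n-\sum_{t\notin\mathcal T,\,n\in\mathcal N}\underline x_{n,t}+\sum_{t\in\mathcal T,\,n\notin\mathcal N}\overline x_{n,t}\ <\ \sum_{t\in\mathcal T}p_t .$$ -/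

import Mathlib

/-- Profiles `(x_{n,t})` in `ℝ^{NT}` with the Euclidean norm. -/
abbrev Profile (N T : ℕ) : Type := EuclideanSpace ℝ (Fin N × Fin T)

/-- The agents' constraints `𝒳 = 𝒳_1 × ⋯ × 𝒳_N`: the row of agent `n` sums to `E n` and lies
between the bounds `lo n` and `hi n`. -/
def agentSet {N T : ℕ} (E : Fin N → ℝ) (lo hi : Fin N → Fin T → ℝ) : Set (Profile N T) :=
  {x | (∀ n, ∑ t, x (n, t) = E n) ∧ ∀ n t, lo n t ≤ x (n, t) ∧ x (n, t) ≤ hi n t}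

/-- The affine space `𝒴_p` of the profiles that aggregate to `p`. -/
def aggregateSet (N : ℕ) {T : ℕ} (p : Fin T → ℝ) : Set (Profile N T) :=
  {y | ∀ t, ∑ n, y (n, t) = p t}

/-- The necessary aggregate conditions on an allocation `p`. -/
def AggregateConditions {N T : ℕ} (E : Fin N → ℝ) (lo hi : Fin N → Fin T → ℝ)
    (p : Fin T → ℝ) : Prop :=
  ∑ t, p t = ∑ n, E n ∧ ∀ t, ∑ n, lo n t ≤ p t ∧ p t ≤ ∑ n, hi n t

/-- `w` is the Euclidean projection of `v` onto `C` (unique when `C` is convex). -/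
def IsEuclideanProjection {N T : ℕ} (C : Set (Profile N T)) (v w : Profile N T) : Prop :=
  w ∈ C ∧ ∀ z ∈ C, ‖v - w‖ ≤ ‖v - z‖

/-- `x^(1), x^(2), …` and `y^(0), y^(1), …` are the infinite sequences of alternate projections
on `X` and `Y` started at the arbitrary point `y^(0)`. The method has no iterate `x^(0)`; the
value `x 0` is unconstrained and never used. -/
def IsAlternateProjections {N T : ℕ} (X Y : Set (Profile N T)) (x y : ℕ → Profile N T) : Prop :=
  ∀ k, IsEuclideanProjection X (y k) (x (k + 1)) ∧
    IsEuclideanProjection Y (x (k + 1)) (y (k + 1))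

/-- `ρ ∈ (0,1)` is a geometric rate of the iterates `x^(1), x^(2), …`. -/
def IsGeometricRate {N T : ℕ} (x : ℕ → Profile N T) (ρ : ℝ) : Prop :=
  0 < ρ ∧ ρ < 1 ∧ ∀ k, 2 ≤ k → ‖x (k + 1) - x k‖ ≤ ρ * ‖x k - x (k - 1)‖

/-- With tolerance `ε` the method stops at iteration `K`: this is the first index at which
two consecutive iterates `x^(K-1), x^(K)` are at distance less than `ε`. -/
def StopsAt {N T : ℕ} (x : ℕ → Profile N T) (ε : ℝ) (K : ℕ) : Prop :=
  IsLeast {k | 2 ≤ k ∧ ‖x k - x (k - 1)‖ < ε} K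

/-- The multiplier `ν_t = (1/N) (p_t - ∑_n x_{n,t})`; it is `y_{n,t} - x_{n,t}` for every `n` when
`y` is the projection of `x` onto `𝒴_p`. -/
noncomputable def multiplier {N T : ℕ} (p : Fin T → ℝ) (x : Profile N T) (t : Fin T) : ℝ :=
  (1 / (N : ℝ)) * (p t - ∑ n, x (n, t))

open scoped Classical in
/-- `𝒯^∞ = {t | 0 < ν_t}`, for the multiplier of the limit point. -/
noncomputable def limitCutSet {N T : ℕ} (p : Fin T → ℝ) (xInf : Profile N T) : Finset (Fin T) :=
  Finset.univ.filter fun t => 0 < multiplier p xInf t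

open scoped Classical in
/-- `𝒯^(K) = {t | B ε < ν_t^(K)}`, for the multiplier of the iterate `x^(K)`. -/
noncomputable def approxCutSet {N T : ℕ} (p : Fin T → ℝ) (B ε : ℝ) (xK : Profile N T) :
    Finset (Fin T) :=
  Finset.univ.filter fun t => B * ε < multiplier p xK t

open scoped Classical in
/-- `𝒯 = {t | ∃ n, y_{n,t} > hi n t}`: the resources of the Hoffman cut. -/
noncomputable def hoffmanResources {N T : ℕ} (hi : Fin N → Fin T → ℝ) (yInf : Profile N T) :
    Finset (Fin T) :=
  Finset.univ.filter fun t => ∃ n, hi n t < yInf (n, t)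

open scoped Classical in
/-- `𝒩 = {n | E_n - ∑_{t ∉ 𝒯} lo n t - ∑_{t ∈ 𝒯} hi n t < 0}`: the agents of the Hoffman cut. -/
noncomputable def hoffmanAgents {N T : ℕ} (E : Fin N → ℝ) (lo hi : Fin N → Fin T → ℝ)
    (S : Finset (Fin T)) : Finset (Fin N) :=
  Finset.univ.filter fun n => E n - ∑ t ∈ Sᶜ, lo n t - ∑ t ∈ S, hi n t < 0

/-- The bound on `∑_{t ∈ S} p_t` in Hoffman's inequality for `S ⊆ [T]` and `M ⊆ [N]`. -/
noncomputable def hoffmanBound {N T : ℕ} (E : Fin N → ℝ) (lo hi : Fin N → Fin T → ℝ)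
    (S : Finset (Fin T)) (M : Finset (Fin N)) : ℝ :=
  ∑ n ∈ M, E n - ∑ t ∈ Sᶜ, ∑ n ∈ M, lo n t + ∑ t ∈ S, ∑ n ∈ Mᶜ, hi n t

/-- `A_S(x) = ∑_{t ∈ S} ∑_n x_{n,t}`. -/
noncomputable def cutValue {N T : ℕ} (S : Finset (Fin T)) (x : Profile N T) : ℝ :=
  ∑ t ∈ S, ∑ n, x (n, t)

/-! At a projection onto `agentSet`, no transfer between two resources of one row can pay, so a row
with slack below `hi` at t and above `lo` at s has residual at t at most its residual at s
(`agentSet_exchange`). If in every row the residuals on S exceed those off S, each row is saturated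
on S or minimal off S, and the cut value is Hoffman's bound, which does not depend on the point
(`cutValue_eq_hoffmanBound`). At the limit the residual is the multiplier, positive exactly on the
cut. At x^(K), with last step length δ, the residual is within δ/(1-ρ) < Bε of it, and the gap `lnu`
> 2Bε preserves the separation. Both points therefore attain the same bound. -/

open Filter Topology

/-! ### Projections onto the two constraint sets -/

section Geometry

variable {N T : ℕ}

theorem multiplier_mul_card (hN : 0 < N) (p : Fin T → ℝ) (x : Profile N T) (t : Fin T) :
    (N : ℝ) * multiplier p x t = p t - ∑ n, x (n, t) := by
  have : (N : ℝ) ≠ 0 := by positivity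
  unfold multiplier
  field_simp

theorem norm_sq_eq_sum_sum (v : Profile N T) : ‖v‖ ^ 2 = ∑ t, ∑ n, v (n, t) ^ 2 := by
  rw [EuclideanSpace.real_norm_sq_eq, Fintype.sum_prod_type, Finset.sum_comm]

theorem sum_column_sq_le_norm_sq (v : Profile N T) (t : Fin T) :
    ∑ n, v (n, t) ^ 2 ≤ ‖v‖ ^ 2 := by
  rw [norm_sq_eq_sum_sum]
  exact Finset.single_le_sum (f := fun t => ∑ n, v (n, t) ^ 2)
    (fun t _ => Finset.sum_nonneg fun n _ => sq_nonneg _) (Finset.mem_univ t)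

theorem abs_column_mean_le_norm (v : Profile N T) (t : Fin T) :
    |(1 / (N : ℝ)) * ∑ n, v (n, t)| ≤ ‖v‖ := by
  rcases Nat.eq_zero_or_pos N with rfl | hN
  · simp
  have hN' : (1 : ℝ) ≤ N := by exact_mod_cast hN
  apply abs_le_of_sq_le_sq _ (norm_nonneg v)
  have h1 : (∑ n, v (n, t)) ^ 2 ≤ N * ∑ n, v (n, t) ^ 2 := by
    simpa using sq_sum_le_card_mul_sum_sq (s := Finset.univ) (f := fun n => v (n, t))
  have h2 := sum_column_sq_le_norm_sq v t
  rw [mul_pow, one_div, inv_pow, inv_mul_le_iff₀ (by positivity)]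
  have h3 : (0 : ℝ) ≤ ∑ n, v (n, t) ^ 2 := Finset.sum_nonneg fun n _ => sq_nonneg _
  nlinarith [sq_nonneg ‖v‖]

/-- Centering a column is an orthogonal projection, so it does not increase the norm; the triangle
inequality would cost a factor 2, hence a larger B. -/
theorem abs_sub_column_mean_le_norm (v : Profile N T) (n : Fin N) (t : Fin T) :
    |v (n, t) - (1 / (N : ℝ)) * ∑ m, v (m, t)| ≤ ‖v‖ := by
  have hN : (0 : ℝ) < N := by exact_mod_cast n.pos
  apply abs_le_of_sq_le_sq _ (norm_nonneg v)
  set c := (1 / (N : ℝ)) * ∑ m, v (m, t) with hc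
  have hs : ∑ m, v (m, t) = N * c := by rw [hc]; field_simp
  have h1 : (v (n, t) - c) ^ 2 ≤ ∑ m, (v (m, t) - c) ^ 2 :=
    Finset.single_le_sum (f := fun m => (v (m, t) - c) ^ 2)
      (fun m _ => sq_nonneg _) (Finset.mem_univ n)
  have h2 : ∑ m, (v (m, t) - c) ^ 2 = ∑ m, v (m, t) ^ 2 - N * c ^ 2 := by
    simp only [sub_sq, Finset.sum_add_distrib, Finset.sum_sub_distrib, ← Finset.sum_mul,
      ← Finset.mul_sum, hs]
    simp
    ring
  have h3 := sum_column_sq_le_norm_sq v t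
  nlinarith [mul_nonneg hN.le (sq_nonneg c)]

theorem multiplier_sub_multiplier (p : Fin T → ℝ) (x z : Profile N T) (t : Fin T) :
    multiplier p x t - multiplier p z t = (1 / (N : ℝ)) * ∑ n, (z - x) (n, t) := by
  simp only [multiplier, PiLp.sub_apply, Finset.sum_sub_distrib]
  ring

theorem abs_multiplier_sub_le (p : Fin T → ℝ) (x z : Profile N T) (t : Fin T) :
    |multiplier p x t - multiplier p z t| ≤ ‖z - x‖ := by
  rw [multiplier_sub_multiplier]
  exact abs_column_mean_le_norm _ t

/-- The projection on `𝒴_p` adds the multiplier to each row. -/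
theorem IsEuclideanProjection.aggregateSet_apply {p : Fin T → ℝ} {x y : Profile N T}
    (h : IsEuclideanProjection (aggregateSet N p) x y) (n : Fin N) (t : Fin T) :
    y (n, t) = x (n, t) + multiplier p x t := by
  have hN := multiplier_mul_card n.pos p x
  let c : Profile N T := WithLp.toLp 2 fun i => x i + multiplier p x i.2
  have hc : c ∈ aggregateSet N p := fun t => by
    simp [c, Finset.sum_add_distrib, hN t]
  -- `x - c` is constant on each column, while `c - y` has zero column sums.
  have horth : inner ℝ (x - c) (c - y) = 0 := by
    rw [PiLp.inner_apply, Fintype.sum_prod_type, Finset.sum_comm]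
    refine Finset.sum_eq_zero fun t _ => ?_
    have : ∀ m : Fin N, inner ℝ ((x - c) (m, t)) ((c - y) (m, t)) =
        -multiplier p x t * (c (m, t) - y (m, t)) := fun m => by
      simp [c]; ring
    rw [Finset.sum_congr rfl fun m _ => this m, ← Finset.mul_sum, Finset.sum_sub_distrib,
      hc t, h.1 t, sub_self, mul_zero]
  have h1 : ‖x - y‖ ^ 2 = ‖x - c‖ ^ 2 + ‖c - y‖ ^ 2 := by
    rw [← sub_add_sub_cancel x c y, norm_add_sq_real, horth]
    ring
  have h2 : ‖x - y‖ ^ 2 ≤ ‖x - c‖ ^ 2 := by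
    gcongr
    exact h.2 c hc
  have h3 : c - y = 0 := by
    rw [← norm_eq_zero, ← sq_eq_zero_iff]
    exact le_antisymm (by linarith) (sq_nonneg _)
  rw [← sub_eq_zero.1 h3]

/-- At the projection on `𝒳` no transfer from `s` to `t` within a row can be profitable. -/
theorem IsEuclideanProjection.agentSet_exchange {E : Fin N → ℝ} {lo hi : Fin N → Fin T → ℝ}
    {v w : Profile N T} (h : IsEuclideanProjection (agentSet E lo hi) v w)
    {n : Fin N} {s t : Fin T} (ht : w (n, t) < hi n t) (hs : lo n s < w (n, s)) :
    v (n, t) - w (n, t) ≤ v (n, s) - w (n, s) := by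
  classical
  by_contra! hlt
  have hst : s ≠ t := by rintro rfl; exact lt_irrefl _ hlt
  set d := (v (n, t) - w (n, t)) - (v (n, s) - w (n, s)) with hd
  have hd0 : 0 < d := sub_pos.2 hlt
  -- Moving by τ changes the squared distance by 2τ² - 2τd, negative for τ ≤ d/2; the other two
  -- bounds keep the row feasible.
  obtain ⟨τ, hτ0, hτ1, hτ2, hτ3⟩ :
      ∃ τ : ℝ, 0 < τ ∧ τ ≤ hi n t - w (n, t) ∧ τ ≤ w (n, s) - lo n s ∧ τ ≤ d / 2 :=
    ⟨min (hi n t - w (n, t)) (min (w (n, s) - lo n s) (d / 2)),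
      lt_min (by linarith) (lt_min (by linarith) (by linarith)), min_le_left _ _,
      (min_le_right _ _).trans (min_le_left _ _), (min_le_right _ _).trans (min_le_right _ _)⟩
  let u : Profile N T := EuclideanSpace.single (n, t) 1 - EuclideanSpace.single (n, s) 1
  have hu : ∀ m r, u (m, r) = (if m = n ∧ r = t then 1 else 0) - if m = n ∧ r = s then 1 else 0 :=
    fun m r => by simp [u]
  have hmem : w + τ • u ∈ agentSet E lo hi := by
    refine ⟨fun m => ?_, fun m r => ?_⟩
    · have : ∑ r, u (m, r) = 0 := by
        simp only [hu, Finset.sum_sub_distrib]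
        by_cases hm : m = n <;> simp [hm]
      simp [Finset.sum_add_distrib, ← Finset.mul_sum, this, h.1.1 m]
    · have hb := h.1.2 m r
      simp only [PiLp.add_apply, PiLp.smul_apply, hu, smul_eq_mul]
      by_cases h1 : m = n ∧ r = t
      · obtain ⟨rfl, rfl⟩ := h1
        simp only [and_self, if_true, true_and, if_neg hst.symm]
        constructor <;> linarith
      by_cases h2 : m = n ∧ r = s
      · obtain ⟨rfl, rfl⟩ := h2
        simp only [and_self, if_true, true_and, if_neg hst]
        constructor <;> linarith
      · simpa [h1, h2] using hb
  have hle : ‖v - w‖ ^ 2 ≤ ‖(v - w) - τ • u‖ ^ 2 := by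
    have := h.2 _ hmem
    rw [← sub_sub] at this
    gcongr
  have hin : inner ℝ (v - w) u = d := by
    simp [u, inner_sub_right, EuclideanSpace.inner_single_right, hd]
  have huu : ‖u‖ ^ 2 = 2 := by
    rw [← real_inner_self_eq_norm_sq]
    have : inner ℝ u u = u (n, t) - u (n, s) := by
      conv_lhs => rw [show u = EuclideanSpace.single (n, t) 1 - EuclideanSpace.single (n, s) 1
        from rfl, inner_sub_right]
      simp [EuclideanSpace.inner_single_right, u]
    rw [this, hu, hu]
    simp [hst, hst.symm]
    norm_num
  rw [norm_sub_sq_real (v - w), inner_smul_right, hin, norm_smul, mul_pow, huu, Real.norm_eq_abs,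
    sq_abs] at hle
  nlinarith

theorem isClosed_agentSet (E : Fin N → ℝ) (lo hi : Fin N → Fin T → ℝ) :
    IsClosed (agentSet E lo hi) := by
  simp only [agentSet, Set.ofPred_and, Set.ofPred_forall]
  refine (isClosed_iInter fun n => isClosed_eq (by fun_prop) (by fun_prop)).inter
    (isClosed_iInter fun n => isClosed_iInter fun t => ?_)
  exact (isClosed_le (by fun_prop) (by fun_prop)).inter (isClosed_le (by fun_prop) (by fun_prop))

theorem isEuclideanProjection_of_tendsto {C : Set (Profile N T)} (hC : IsClosed C)
    {v w : ℕ → Profile N T} {a b : Profile N T} (h : ∀ k, IsEuclideanProjection C (v k) (w k))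
    (hv : Tendsto v atTop (𝓝 a)) (hw : Tendsto w atTop (𝓝 b)) :
    IsEuclideanProjection C a b :=
  ⟨hC.mem_of_tendsto hw (Eventually.of_forall fun k => (h k).1), fun z hz =>
    le_of_tendsto_of_tendsto' (hv.sub hw).norm (hv.sub_const z).norm fun k => (h k).2 z hz⟩

end Geometry

/-! ### Convergence and stopping from the geometric rate -/

section Rate

variable {N T : ℕ} {x : ℕ → Profile N T} {ρ : ℝ}

theorem IsGeometricRate.dist_le (h : IsGeometricRate x ρ) {K : ℕ} (hK : 2 ≤ K) (j : ℕ) :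
    dist (x (K + j)) (x (K + (j + 1))) ≤ ρ * ‖x K - x (K - 1)‖ * ρ ^ j := by
  induction j with
  | zero =>
    rw [dist_comm, dist_eq_norm]
    simpa using h.2.2 K hK
  | succ j ih =>
    have h1 := h.2.2 (K + (j + 1)) (by omega)
    rw [dist_comm, dist_eq_norm] at ih ⊢
    calc _ ≤ _ := h1
      _ ≤ ρ * (ρ * ‖x K - x (K - 1)‖ * ρ ^ j) := mul_le_mul_of_nonneg_left ih h.1.le
      _ = _ := by ring

theorem IsGeometricRate.exists_tendsto (h : IsGeometricRate x ρ) :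
    ∃ a, Tendsto x atTop (𝓝 a) := by
  obtain ⟨a, ha⟩ := cauchySeq_tendsto_of_complete
    (cauchySeq_of_le_geometric _ _ h.2.1 (h.dist_le le_rfl))
  refine ⟨a, (tendsto_add_atTop_iff_nat 2).1 ?_⟩
  simpa only [add_comm] using ha

theorem IsGeometricRate.norm_sub_limit_le (h : IsGeometricRate x ρ) {a : Profile N T}
    (ha : Tendsto x atTop (𝓝 a)) {K : ℕ} (hK : 2 ≤ K) :
    ‖x K - a‖ ≤ ρ * ‖x K - x (K - 1)‖ / (1 - ρ) := by
  have ha' : Tendsto (fun j => x (K + j)) atTop (𝓝 a) := by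
    simpa only [add_comm] using (tendsto_add_atTop_iff_nat K).2 ha
  rw [← dist_eq_norm]
  exact dist_le_of_le_geometric_of_tendsto₀ _ _ h.2.1 (h.dist_le hK) ha'

theorem exists_stopsAt {a : Profile N T} (ha : Tendsto x atTop (𝓝 a)) {ε : ℝ} (hε : 0 < ε) :
    ∃ K, StopsAt x ε K := by
  have h0 : Tendsto (fun k => ‖x (k + 1) - x k‖) atTop (𝓝 0) := by
    simpa using (((tendsto_add_atTop_iff_nat 1).2 ha).sub ha).norm
  obtain ⟨k, hk, hk1⟩ := ((h0.eventually_lt_const hε).and (eventually_ge_atTop 1)).exists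
  have hne : {k | 2 ≤ k ∧ ‖x k - x (k - 1)‖ < ε}.Nonempty := ⟨k + 1, by omega, by simpa using hk⟩
  exact ⟨_, Nat.sInf_mem hne, fun _ hm => Nat.sInf_le hm⟩

end Rate

/-! ### Hoffman cuts from saturated rows -/

section Cut

variable {N T : ℕ} {E : Fin N → ℝ} {lo hi : Fin N → Fin T → ℝ} {p : Fin T → ℝ}

theorem sum_multiplier_eq_zero (hp : ∑ t, p t = ∑ n, E n) {x : Profile N T}
    (hx : x ∈ agentSet E lo hi) : ∑ t, multiplier p x t = 0 := by
  simp only [multiplier]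
  rw [← Finset.mul_sum, Finset.sum_sub_distrib, Finset.sum_comm, hp,
    Finset.sum_congr rfl fun n _ => hx.1 n, sub_self, mul_zero]

/-- If no row of `x` has both slack below `hi` on `S` and slack above `lo` off `S`, then
Hoffman's bound for `S` is attained at `x`. -/
theorem cutValue_eq_hoffmanBound {S : Finset (Fin T)} {x : Profile N T}
    (hx : x ∈ agentSet E lo hi)
    (hexch : ∀ n, ∀ t ∈ S, ∀ s ∉ S, x (n, t) < hi n t → lo n s < x (n, s) → False) :
    cutValue S x = hoffmanBound E lo hi S (hoffmanAgents E lo hi S) := by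
  have hrow : ∀ n, ∑ t ∈ S, x (n, t) + ∑ t ∈ Sᶜ, x (n, t) = E n := fun n => by
    rw [Finset.sum_add_sum_compl]; exact hx.1 n
  have hhi : ∀ n, ∑ t ∈ S, x (n, t) ≤ ∑ t ∈ S, hi n t := fun n =>
    Finset.sum_le_sum fun t _ => (hx.2 n t).2
  have hlo : ∀ n, ∑ t ∈ Sᶜ, lo n t ≤ ∑ t ∈ Sᶜ, x (n, t) := fun n =>
    Finset.sum_le_sum fun t _ => (hx.2 n t).1
  have hcase : ∀ n, ∑ t ∈ S, x (n, t) = ∑ t ∈ S, hi n t ∨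
      ∑ t ∈ Sᶜ, x (n, t) = ∑ t ∈ Sᶜ, lo n t := fun n => by
    by_cases h : ∃ t ∈ S, x (n, t) < hi n t
    · obtain ⟨t, ht, htl⟩ := h
      refine Or.inr (Finset.sum_congr rfl fun s hs => ?_)
      by_contra hne
      exact hexch n t ht s (Finset.mem_compl.1 hs) htl
        (lt_of_le_of_ne (hx.2 n s).1 (Ne.symm hne))
    · push Not at h
      exact Or.inl (Finset.sum_congr rfl fun t ht => le_antisymm (hx.2 n t).2 (h t ht))
  -- The row's sum over S attains the smaller of its two upper bounds; the sign defining
  -- `hoffmanAgents` tells which.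
  have hval : ∀ n, ∑ t ∈ S, x (n, t) = if n ∈ hoffmanAgents E lo hi S
      then E n - ∑ t ∈ Sᶜ, lo n t else ∑ t ∈ S, hi n t := fun n => by
    have h1 := hrow n
    have h2 := hhi n
    have h3 := hlo n
    simp only [hoffmanAgents, Finset.mem_filter, Finset.mem_univ, true_and]
    split_ifs with h <;> rcases hcase n with h4 | h4 <;> linarith
  rw [cutValue, hoffmanBound, Finset.sum_comm, Finset.sum_congr rfl fun n _ => hval n,
    ← Finset.sum_add_sum_compl (hoffmanAgents E lo hi S), Finset.sum_comm (s := Sᶜ),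
    Finset.sum_comm (s := S), ← Finset.sum_sub_distrib]
  congr 1
  · exact Finset.sum_congr rfl fun n hn => if_pos hn
  · exact Finset.sum_congr rfl fun n hn => if_neg (Finset.mem_compl.1 hn)

/-- At a fixed point of the alternate projections, the resources where `y` overshoots some upper
bound are those with a positive multiplier. -/
theorem limitCutSet_eq_hoffmanResources (hp : AggregateConditions E lo hi p)
    {x y : Profile N T} (hx : IsEuclideanProjection (agentSet E lo hi) y x)
    (hy : ∀ n t, y (n, t) = x (n, t) + multiplier p x t) :
    limitCutSet p x = hoffmanResources hi y := by
  ext t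
  simp only [limitCutSet, hoffmanResources, Finset.mem_filter, Finset.mem_univ, true_and]
  constructor
  · intro ht
    by_contra! hall
    -- For N = 0 the convention 1/0 = 0 makes the multiplier vanish.
    have hN : 0 < N := by
      rcases Nat.eq_zero_or_pos N with rfl | hN
      · simp [multiplier] at ht
      · exact hN
    -- Every row has slack at t, so a negative multiplier at s would push all of column s to its
    -- lower bounds, giving p_s < ∑ lo. Nonnegative multipliers with zero sum then all vanish.
    have hnonneg : ∀ s, 0 ≤ multiplier p x s := fun s => by
      by_contra! hs
      have hlow : ∀ n, x (n, s) = lo n s := fun n => by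
        by_contra hne
        have hex := hx.agentSet_exchange (n := n) (t := t) (s := s)
          (by linarith [hall n, hy n t]) (lt_of_le_of_ne (hx.1.2 n s).1 (Ne.symm hne))
        linarith [hy n t, hy n s]
      have h1 := multiplier_mul_card hN p x s
      have h2 := (hp.2 s).1
      rw [Finset.sum_congr rfl fun n _ => hlow n] at h1
      have h3 : (N : ℝ) * multiplier p x s < 0 := mul_neg_of_pos_of_neg (by exact_mod_cast hN) hs
      linarith
    have h0 := (Finset.sum_eq_zero_iff_of_nonneg fun s _ => hnonneg s).1
      (sum_multiplier_eq_zero hp.1 hx.1) t (Finset.mem_univ t)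
    exact ht.ne' h0
  · rintro ⟨n, hn⟩
    linarith [(hx.1.2 n t).2, hy n t]

/-- The multipliers sum to zero without all vanishing, so the cut is nonempty, and each of its
resources is strictly underserved. -/
theorem cutValue_limitCutSet_lt (hp : ∑ t, p t = ∑ n, E n) {x : Profile N T}
    (hx : x ∈ agentSet E lo hi) (hne : ∃ t, multiplier p x t ≠ 0) :
    cutValue (limitCutSet p x) x < ∑ t ∈ limitCutSet p x, p t := by
  obtain ⟨t, ht⟩ := hne
  have hN : 0 < N := by
    rcases Nat.eq_zero_or_pos N with rfl | hN
    · simp [multiplier] at ht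
    · exact hN
  obtain ⟨s, -, hs⟩ := Finset.exists_pos_of_sum_zero_of_exists_nonzero _
    (sum_multiplier_eq_zero hp hx) ⟨t, Finset.mem_univ t, ht⟩
  refine Finset.sum_lt_sum_of_nonempty ⟨s, by simpa [limitCutSet] using hs⟩ fun r hr => ?_
  have hr' : 0 < multiplier p x r := by simpa [limitCutSet] using hr
  have := mul_pos (Nat.cast_pos.2 hN : (0 : ℝ) < N) hr'
  rw [multiplier_mul_card hN] at this
  linarith

end Cut

theorem mainTheorem5 {N T : ℕ} (E : Fin N → ℝ) (lo hi : Fin N → Fin T → ℝ) (p : Fin T → ℝ)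
    (hE : ∀ n, 0 < E n) (hX : (agentSet E lo hi).Nonempty)
    (hp : AggregateConditions E lo hi p)
    (x y : ℕ → Profile N T)
    (hxy : IsAlternateProjections (agentSet E lo hi) (aggregateSet N p) x y)
    (ρ : ℝ) (hρ : IsGeometricRate x ρ) :
    ∃ xInf yInf : Profile N T,
      Filter.Tendsto x Filter.atTop (nhds xInf) ∧ Filter.Tendsto y Filter.atTop (nhds yInf) ∧
      ∀ lnu B ε : ℝ,
        IsLeast {a : ℝ | ∃ t, a = |multiplier p xInf t| ∧ 0 < |multiplier p xInf t|} lnu →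
        1 / (1 - ρ) < B → 0 < ε → ε * (2 * B) < lnu →
        (∃ K, StopsAt x ε K) ∧
        ∀ K, StopsAt x ε K →
          approxCutSet p B ε (x K) = hoffmanResources hi yInf ∧
          limitCutSet p xInf = hoffmanResources hi yInf ∧
          cutValue (hoffmanResources hi yInf) (x K) =
            cutValue (hoffmanResources hi yInf) xInf ∧
          cutValue (hoffmanResources hi yInf) xInf =
            hoffmanBound E lo hi (hoffmanResources hi yInf)
              (hoffmanAgents E lo hi (hoffmanResources hi yInf)) ∧
          cutValue (hoffmanResources hi yInf) xInf < ∑ t ∈ hoffmanResources hi yInf, p t := by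
  obtain ⟨a, ha⟩ := hρ.exists_tendsto
  have hyx : ∀ k n t, y (k + 1) (n, t) = x (k + 1) (n, t) + multiplier p (x (k + 1)) t :=
    fun k => (hxy k).2.aggregateSet_apply
  have ha1 : Tendsto (fun k => x (k + 1)) atTop (𝓝 a) := (tendsto_add_atTop_iff_nat 1).2 ha
  let b : Profile N T := WithLp.toLp 2 fun i => a i + multiplier p a i.2
  have hb : ∀ n t, b (n, t) = a (n, t) + multiplier p a t := fun n t => rfl
  have hyb : Tendsto y atTop (𝓝 b) := by
    have hF : Continuous fun z : Profile N T =>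
        (WithLp.toLp 2 fun i => z i + multiplier p z i.2 : Profile N T) := by
      unfold multiplier
      fun_prop
    refine (tendsto_add_atTop_iff_nat 1).1 (((hF.tendsto a).comp ha1).congr fun k => ?_)
    ext ⟨n, t⟩
    exact (hyx k n t).symm
  have hab : IsEuclideanProjection (agentSet E lo hi) b a :=
    isEuclideanProjection_of_tendsto (isClosed_agentSet E lo hi) (fun k => (hxy k).1) hyb ha1
  refine ⟨a, b, ha, hyb, fun lnu B ε hlnu hB hε hBε => ⟨exists_stopsAt ha hε, fun K hK => ?_⟩⟩
  have hlim := limitCutSet_eq_hoffmanResources hp hab hb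
  rw [← hlim]
  have hgap : ∀ t, 0 < multiplier p a t → lnu ≤ multiplier p a t := fun t ht =>
    hlnu.2 ⟨t, (abs_of_pos ht).symm, abs_pos.2 ht.ne'⟩
  have hmem : ∀ t, t ∈ limitCutSet p a ↔ 0 < multiplier p a t := fun t => by simp [limitCutSet]
  obtain ⟨⟨hK2, hKε⟩, -⟩ := hK
  have hρ1 : 0 < 1 - ρ := sub_pos.2 hρ.2.1
  set δ := ‖x K - x (K - 1)‖ with hδ
  have hδ0 : 0 ≤ δ := norm_nonneg _
  -- The first term bounds the distance to the limit, the second the gap between y^(K-1) - x^(K) and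
  -- ν^(K); their sum is the origin of B > 1/(1-ρ).
  have hsplit : ρ * δ / (1 - ρ) + δ = 1 / (1 - ρ) * δ := by field_simp; ring
  have hsmall : ρ * δ / (1 - ρ) + δ < B * ε := by
    rw [hsplit]
    exact mul_lt_mul'' hB hKε (by positivity) hδ0
  have hν : ∀ t, |multiplier p a t - multiplier p (x K) t| ≤ ρ * δ / (1 - ρ) := fun t =>
    (abs_multiplier_sub_le p a (x K) t).trans (hρ.norm_sub_limit_le ha hK2)
  have hlimval : cutValue (limitCutSet p a) a = hoffmanBound E lo hi (limitCutSet p a)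
      (hoffmanAgents E lo hi (limitCutSet p a)) := by
    refine cutValue_eq_hoffmanBound hab.1 fun n t ht s hs h1 h2 => ?_
    have := hab.agentSet_exchange h1 h2
    rw [hmem] at ht hs
    linarith [hb n t, hb n s]
  refine ⟨?_, rfl, ?_, hlimval, ?_⟩
  · ext t
    rw [hmem]
    simp only [approxCutSet, Finset.mem_filter, Finset.mem_univ, true_and]
    have h1 := abs_le.1 (hν t)
    constructor
    · intro h
      linarith
    · intro h
      linarith [hgap t h]
  · obtain ⟨k, rfl⟩ : ∃ k, K = k + 2 := ⟨K - 2, by omega⟩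
    have hproj := (hxy (k + 1)).1
    -- The deviation is exactly the column-centered entry of x^(K-1) - x^(K).
    have hdev : ∀ n t, |y (k + 1) (n, t) - x (k + 2) (n, t) - multiplier p (x (k + 2)) t| ≤ δ :=
      fun n t => by
        have h1 := abs_sub_column_mean_le_norm (x (k + 1) - x (k + 2)) n t
        rw [← multiplier_sub_multiplier p, norm_sub_rev] at h1
        refine le_trans (le_of_eq ?_) h1
        rw [hyx, PiLp.sub_apply]
        congr 1
        ring
    rw [hlimval]
    refine cutValue_eq_hoffmanBound hproj.1 fun n t ht s hs h1 h2 => ?_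
    have hex := hproj.agentSet_exchange h1 h2
    rw [hmem] at ht hs
    -- The residual exceeds Bε at t and is below Bε at s, contradicting the exchange inequality.
    have h3 := abs_le.1 (hν t)
    have h4 := abs_le.1 (hν s)
    have h5 := abs_le.1 (hdev n t)
    have h6 := abs_le.1 (hdev n s)
    linarith [hgap t ht]
  · refine cutValue_limitCutSet_lt hp.1 hab.1 ?_
    obtain ⟨t, -, ht⟩ := hlnu.1
    exact ⟨t, abs_pos.1 ht⟩
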